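/- Let $n\ge 2$ and let $\mathbb B^n=\{z\in\mathbb R^n : |z|<1\}$ be the Euclidean unit ball. Let $\rho$ be the hyperbolic metric of $\mathbb B^n$, $\rho(x,y)=\inf_\gamma\int_\gamma \frac{2\,|dz|}{1-|z|^2}$, where the infimum is over all rectifiable curves $\gamma$ in $\mathbb B^n$ joining $x$ and $y$, and let $j$ be the distance ratio metric of $\mathbb B^n$, $j(x,y)=\log\Bigl(1+\frac{|x-y|}{\min\{d(x),d(y)\}}\Bigr)$, where $d(z)$ is the Euclidean distance from $z$ to $\partial\mathbb B^n$. For $d\in\{\rho,j\}$ write $B_d(x,r)=\{y\in\mathbb B^n : d(x,y)<r\}$. Let $x\in\mathbb B^n$. For $r>0$ put $$m=m(r)=\log\Bigl(1+\frac{2(e^r-1)}{1+|x|}\Bigr),\qquad M=M(r)=\min\Bigl\{2\operatorname{arcsinh}\frac{e^r-1}{1+|x|},\ \log\frac{2e^r-1-|x|}{1-|x|}\Bigr\}.$$ Then for every $r>0$ $$B_\rho(x,m)\subset B_j(x,r)\subset B_\rho(x,M),$$ and these inclusions are sharp: if $B_\rho(x,s)\subset B_j(x,r)$, then $s\le m$,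 and if $B_j(x,r)\subset B_\rho(x,s)$, then $s\ge M$. Moreover, $M(r)/m(r)\to 1$ as $r\to 0^+$. -/

import Mathlib

noncomputable section

/-- The points of Euclidean `n`-space. -/
abbrev Euc (n : ℕ) : Type := EuclideanSpace ℝ (Fin n)

/-- The open unit ball of Euclidean `n`-space, centred at the origin. -/
def unitBall (n : ℕ) : Set (Euc n) := Metric.ball 0 1

/-- `γ`, restricted to `[a, b]`, is a rectifiable curve in `G` joining `x` and `y`: it is continuous
and has finite Euclidean length (total variation) on `[a, b]`. -/
structure IsRectifiableCurve {n : ℕ} (G : Set (Euc n)) (x y : Euc n)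
    (γ : ℝ → Euc n) (a b : ℝ) : Prop where
  le : a ≤ b
  continuousOn : ContinuousOn γ (Set.Icc a b)
  rectifiable : BoundedVariationOn γ (Set.Icc a b)
  mapsTo : Set.MapsTo γ (Set.Icc a b) G
  left : γ a = x
  right : γ b = y

/-- The line integral `∫_γ w |dz|` of a function `w` with respect to arc length along a rectifiable
curve `γ : [a, b] → ℝⁿ`, that is `∫₀^ℓ w (σ s) ds`, where `ℓ` is the Euclidean length of `γ` and `σ`
is its parametrization by arc length. -/
def arcLengthIntegral {n : ℕ} (w : Euc n → ℝ) (γ : ℝ → Euc n) (a b : ℝ) : ℝ :=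
  ∫ s in (0 : ℝ)..(eVariationOn γ (Set.Icc a b)).toReal,
    w (naturalParameterization γ (Set.Icc a b) a s)

/-- The hyperbolic length `∫_γ 2 |dz| / (1 - |z|²)` of a rectifiable curve in the unit ball. -/
def hyperbolicLength {n : ℕ} (γ : ℝ → Euc n) (a b : ℝ) : ℝ :=
  arcLengthIntegral (fun z => 2 / (1 - ‖z‖ ^ 2)) γ a b

/-- The hyperbolic metric `ρ` of the unit ball: the infimum of the hyperbolic lengths of all
rectifiable curves in the unit ball joining `x` and `y`. -/
def hyperbolicDist {n : ℕ} (x y : Euc n) : ℝ :=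
  sInf {l : ℝ | ∃ (γ : ℝ → Euc n) (a b : ℝ),
    IsRectifiableCurve (unitBall n) x y γ a b ∧ l = hyperbolicLength γ a b}

/-- The distance ratio metric `j_G` of a proper subdomain `G`; the Euclidean distance from a point
to the boundary of `G` is `Metric.infDist · (frontier G)`. -/
def distanceRatioDist {n : ℕ} (G : Set (Euc n)) (x y : Euc n) : ℝ :=
  Real.log (1 + dist x y / min (Metric.infDist x (frontier G)) (Metric.infDist y (frontier G)))

/-- The metric ball `B_d(x, r) = {y ∈ X | d(x, y) < r}` of a distance function `d` on a set `X`. -/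
def metricBall {n : ℕ} (X : Set (Euc n)) (d : Euc n → Euc n → ℝ) (x : Euc n) (r : ℝ) :
    Set (Euc n) :=
  {y | y ∈ X ∧ d x y < r}

/-- The hyperbolic ball `B_ρ(x, r)` in the unit ball. -/
def rhoBall {n : ℕ} (x : Euc n) (r : ℝ) : Set (Euc n) :=
  metricBall (unitBall n) hyperbolicDist x r

/-- The `j`-metric ball `B_j(x, r)` in the unit ball. -/
def jBall {n : ℕ} (x : Euc n) (r : ℝ) : Set (Euc n) :=
  metricBall (unitBall n) (distanceRatioDist (unitBall n)) x r

/-- The radius `m = log (1 + 2 (e^r - 1) / (1 + |x|))`. -/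
def innerRadius {n : ℕ} (x : Euc n) (r : ℝ) : ℝ :=
  Real.log (1 + 2 * (Real.exp r - 1) / (1 + ‖x‖))

/-- The radius `M = min {2 arcsinh ((e^r - 1) / (1 + |x|)), log ((2 e^r - 1 - |x|) / (1 - |x|))}`. -/
def outerRadius {n : ℕ} (x : Euc n) (r : ℝ) : ℝ :=
  min (2 * Real.arsinh ((Real.exp r - 1) / (1 + ‖x‖)))
    (Real.log ((2 * Real.exp r - 1 - ‖x‖) / (1 - ‖x‖)))

end

open Set Filter Topology

/-! The hyperbolic metric has the closed form `ballDist`, ρ(x,y) = 2 arsinh(|x-y| /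
√((1-|x|²)(1-|y|²))). It is a lower bound for the length of every curve: it satisfies the triangle
inequality (Ptolemy) and is infinitesimally at most 2|dz|/(1-|z|²), so `ballDist_le_integral` can
compare slopes along an arc length parametrization. It is attained on the curve that a plane section
of the hyperboloid projects to (`exists_isBallGeodesic`, `IsBallGeodesic.hyperbolicLength_le`).

Put c = e^r - 1, t = |x|, s = |y|, u = |x-y|. Then y lies in the j-ball iff u < c(1-t) and u <
c(1-s), and once m and M are written as values of 2 arsinh, both inclusions are polynomial
inequalities in t, s, u, c subject to |s-t| ≤ u ≤ s+t.

The extremal points give sharpness. For m it is the point with s-t = c(1-s) on the radius through x,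
beyond x. For M it is the point with s+t = c(1-s) on the opposite radius if that point has s ≥ t,
and otherwise a point with s = t and u = c(1-t), whose construction needs a second dimension.
Finally m and M both have slope 2/(1+t) at r = 0+. -/

/-! ### Parametrization by arc length. -/

theorem ContinuousOn.variationOnFromTo {E : Type*} [PseudoMetricSpace E] {γ : ℝ → E} {s : Set ℝ}
    {a : ℝ} (ha : a ∈ s) (hγ : ContinuousOn γ s) (hv : LocallyBoundedVariationOn γ s) :
    ContinuousOn (variationOnFromTo γ s a) s := by
  intro b hb
  -- At `b` the variation jumps by the distance from `γ b` to the one-sided limit of `γ`, which is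
  -- zero by continuity.
  have hl := variationOnFromTo.tendsto_left ha hb hv
    ((hγ b hb).mono_left (nhdsWithin_mono _ inter_subset_left))
  have hr := variationOnFromTo.tendsto_right ha hb hv
    ((hγ b hb).mono_left (nhdsWithin_mono _ inter_subset_left))
  rw [dist_self, sub_zero] at hl
  rw [dist_self, add_zero] at hr
  have hs : s ⊆ (s ∩ Iio b ∪ s ∩ Ioi b) ∪ {b} := by
    intro z hz
    rcases lt_trichotomy z b with h | h | h
    · exact Or.inl (Or.inl ⟨hz, h⟩)
    · exact Or.inr h
    · exact Or.inl (Or.inr ⟨hz, h⟩)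
  refine ContinuousWithinAt.mono ?_ hs
  exact (ContinuousWithinAt.union hl hr).union continuousWithinAt_singleton

theorem variationOnFromTo_Icc_right {E : Type*} [PseudoMetricSpace E] {γ : ℝ → E} {a b : ℝ}
    (hab : a ≤ b) :
    variationOnFromTo γ (Icc a b) a b = (eVariationOn γ (Icc a b)).toReal := by
  rw [variationOnFromTo.eq_of_le _ _ hab, inter_self]

/-- A continuous monotone function takes all intermediate values. Unit speed of the natural
parameterization is known only on this image, so the image has to be the full interval. -/
theorem image_variationOnFromTo_Icc {E : Type*} [PseudoMetricSpace E] {γ : ℝ → E} {a b : ℝ}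
    (hab : a ≤ b) (hγ : ContinuousOn γ (Icc a b)) (hv : BoundedVariationOn γ (Icc a b)) :
    variationOnFromTo γ (Icc a b) a '' Icc a b =
      Icc 0 (eVariationOn γ (Icc a b)).toReal := by
  have ha : a ∈ Icc a b := left_mem_Icc.2 hab
  have hb : b ∈ Icc a b := right_mem_Icc.2 hab
  have hm := variationOnFromTo.monotoneOn hv.locallyBoundedVariationOn ha
  rw [← variationOnFromTo_Icc_right hab]
  apply Subset.antisymm
  · rintro _ ⟨t, ht, rfl⟩
    exact ⟨variationOnFromTo.nonneg_of_le _ _ ht.1, hm ht hb ht.2⟩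
  · have := intermediate_value_Icc hab (hγ.variationOnFromTo ha hv.locallyBoundedVariationOn)
    rwa [variationOnFromTo.self] at this

/-- A rectifiable curve has a globally defined `1`-Lipschitz parametrization by arc length. -/
theorem IsRectifiableCurve.exists_arcLength {n : ℕ} {G : Set (Euc n)} {x y : Euc n}
    {γ : ℝ → Euc n} {a b : ℝ} (h : IsRectifiableCurve G x y γ a b) :
    ∃ σ : ℝ → Euc n, LipschitzWith 1 σ ∧ (∀ s, σ s ∈ G) ∧
      (∀ t ∈ Icc a b, σ (variationOnFromTo γ (Icc a b) a t) = γ t) ∧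
      ∀ w : Euc n → ℝ, arcLengthIntegral w γ a b =
        ∫ s in (0 : ℝ)..(eVariationOn γ (Icc a b)).toReal, w (σ s) := by
  have ha : a ∈ Icc a b := left_mem_Icc.2 h.le
  have hv := h.rectifiable.locallyBoundedVariationOn
  set ℓ := (eVariationOn γ (Icc a b)).toReal with hℓ
  have hℓ0 : (0 : ℝ) ≤ ℓ := ENNReal.toReal_nonneg
  set ν := naturalParameterization γ (Icc a b) a with hν
  have him := image_variationOnFromTo_Icc h.le h.continuousOn h.rectifiable
  have hνγ : ∀ t ∈ Icc a b, ν (variationOnFromTo γ (Icc a b) a t) = γ t := fun t ht =>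
    edist_eq_zero.1 (edist_naturalParameterization_eq_zero hv ha ht)
  have hunit := has_unit_speed_naturalParameterization γ hv ha
  rw [him] at hunit
  have hlip : LipschitzOnWith 1 ν (Icc 0 ℓ) := by
    have key : ∀ p ∈ Icc 0 ℓ, ∀ q ∈ Icc 0 ℓ, p ≤ q → edist (ν p) (ν q) ≤ edist p q := by
      intro p hp q hq hpq
      calc edist (ν p) (ν q) ≤ eVariationOn ν (Icc 0 ℓ ∩ Icc p q) :=
            eVariationOn.edist_le _ ⟨hp, left_mem_Icc.2 hpq⟩ ⟨hq, right_mem_Icc.2 hpq⟩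
        _ = ENNReal.ofReal (q - p) := by
            rw [hunit hp hq]; simp
        _ = edist p q := by
            rw [edist_dist, dist_comm, Real.dist_eq, abs_of_nonneg (sub_nonneg.2 hpq)]
    intro p hp q hq
    rw [ENNReal.coe_one, one_mul]
    rcases le_total p q with hpq | hpq
    · exact key p hp q hq hpq
    · rw [edist_comm, edist_comm p]
      exact key q hq p hp hpq
  -- Extending by constants outside `[0, ℓ]` keeps the curve `1`-Lipschitz and in `G`, so integrands
  -- along it are continuous on all of `ℝ`.
  refine ⟨fun s => ν (projIcc 0 ℓ hℓ0 s), ?_, ?_, ?_, ?_⟩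
  · have h1 := (hlip.to_restrict).comp (LipschitzWith.projIcc hℓ0)
    rw [one_mul] at h1
    exact h1
  · intro s
    obtain ⟨t, ht, hts⟩ := him.symm.subset (projIcc 0 ℓ hℓ0 s).2
    simp only [← hts, hνγ t ht]
    exact h.mapsTo ht
  · intro t ht
    have : variationOnFromTo γ (Icc a b) a t ∈ Icc 0 ℓ := him ▸ mem_image_of_mem _ ht
    simp only [projIcc_of_mem hℓ0 this, hνγ t ht]
  · intro w
    apply intervalIntegral.integral_congr
    intro s hs
    rw [uIcc_of_le hℓ0] at hs
    simp only [projIcc_of_mem hℓ0 hs, hν]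

/-! ### The closed form as a lower bound for hyperbolic length. -/

/-- The closed form of the hyperbolic distance of the unit ball. -/
noncomputable def ballDist {n : ℕ} (x y : Euc n) : ℝ :=
  2 * Real.arsinh (dist x y / √((1 - ‖x‖ ^ 2) * (1 - ‖y‖ ^ 2)))

theorem one_sub_norm_sq_pos {n : ℕ} {x : Euc n} (hx : x ∈ unitBall n) : 0 < 1 - ‖x‖ ^ 2 := by
  have h : ‖x‖ < 1 := by simpa [unitBall] using hx
  nlinarith [norm_nonneg x]

theorem ballDist_self {n : ℕ} (x : Euc n) : ballDist x x = 0 := by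
  simp [ballDist]

theorem ballDist_nonneg {n : ℕ} (x y : Euc n) : 0 ≤ ballDist x y := by
  rw [ballDist]
  have := Real.arsinh_nonneg_iff.2
    (div_nonneg (dist_nonneg (x := x) (y := y)) (Real.sqrt_nonneg ((1 - ‖x‖ ^ 2) * (1 - ‖y‖ ^ 2))))
  linarith

/-- A consequence of Ptolemy's inequality for `x`, `y`, `z` and the inverse of `y` in the unit
sphere. -/
theorem dist_mul_one_sub_le {n : ℕ} {x y z : Euc n} (hy : ‖y‖ < 1) :
    dist x z * (1 - ‖y‖ ^ 2) ≤
      dist x y * √(dist y z ^ 2 + (1 - ‖y‖ ^ 2) * (1 - ‖z‖ ^ 2)) +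
      dist y z * √(dist x y ^ 2 + (1 - ‖x‖ ^ 2) * (1 - ‖y‖ ^ 2)) := by
  -- The inverse of `0` is the point at infinity, where Ptolemy degenerates to the triangle
  -- inequality.
  rcases eq_or_ne y 0 with rfl | hy0
  · have e : ∀ w : Euc n, ‖w‖ ^ 2 + (1 - ‖w‖ ^ 2) = 1 := fun w => by ring
    simp only [dist_zero_left, dist_zero_right, norm_zero, ne_eq, OfNat.ofNat_ne_zero,
      not_false_eq_true, zero_pow, sub_zero, one_mul, mul_one, e, Real.sqrt_one]
    rw [dist_eq_norm]
    exact norm_sub_le x z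
  have hny : 0 < ‖y‖ := norm_pos_iff.2 hy0
  set v : Euc n := (‖y‖ ^ 2)⁻¹ • y with hv
  have key : ∀ w : Euc n, √(dist y w ^ 2 + (1 - ‖y‖ ^ 2) * (1 - ‖w‖ ^ 2)) = ‖y‖ * dist w v := by
    intro w
    rw [← Real.sqrt_sq (mul_nonneg hny.le (dist_nonneg (x := w) (y := v)))]
    congr 1
    rw [mul_pow, dist_eq_norm, dist_eq_norm, norm_sub_sq_real, norm_sub_sq_real, hv, norm_smul,
      inner_smul_right, real_inner_comm]
    simp only [norm_inv, norm_pow, norm_norm]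
    field_simp
    ring
  have hyv : ‖y‖ * dist y v = 1 - ‖y‖ ^ 2 := by
    rw [← key y, dist_self, show (0 : ℝ) ^ 2 + (1 - ‖y‖ ^ 2) * (1 - ‖y‖ ^ 2) =
      (1 - ‖y‖ ^ 2) ^ 2 by ring, Real.sqrt_sq (by nlinarith)]
  have hP := EuclideanGeometry.mul_dist_le_mul_dist_add_mul_dist x y z v
  rw [dist_comm x y, key, mul_comm (1 - ‖x‖ ^ 2), key, ← hyv]
  rw [dist_comm x y] at hP
  nlinarith [mul_le_mul_of_nonneg_left hP hny.le]

/-- Applying sinh and its addition formula to the half distances, then clearing square roots, leaves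
exactly `dist_mul_one_sub_le`. -/
theorem ballDist_triangle {n : ℕ} {x y z : Euc n} (hx : x ∈ unitBall n) (hy : y ∈ unitBall n)
    (hz : z ∈ unitBall n) : ballDist x z ≤ ballDist x y + ballDist y z := by
  have hX := one_sub_norm_sq_pos hx
  have hY := one_sub_norm_sq_pos hy
  have hZ := one_sub_norm_sq_pos hz
  simp only [ballDist]
  rw [← mul_add]
  refine mul_le_mul_of_nonneg_left ?_ zero_le_two
  rw [← Real.sinh_le_sinh, Real.sinh_add, Real.sinh_arsinh, Real.sinh_arsinh, Real.sinh_arsinh,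
    Real.cosh_arsinh, Real.cosh_arsinh]
  have key := dist_mul_one_sub_le (x := x) (y := y) (z := z)
    (by simpa [unitBall] using hy)
  set X := 1 - ‖x‖ ^ 2
  set Y := 1 - ‖y‖ ^ 2
  set Z := 1 - ‖z‖ ^ 2
  have e : ∀ d P Q : ℝ, 0 < P → 0 < Q → √(1 + (d / √(P * Q)) ^ 2) = √(d ^ 2 + P * Q) / √(P * Q) := by
    intro d P Q hP hQ
    rw [← Real.sqrt_div (by positivity), div_pow, Real.sq_sqrt (by positivity)]
    congr 1
    field_simp
    ring
  rw [e _ _ _ hX hY, e _ _ _ hY hZ, Real.sqrt_mul hX.le, Real.sqrt_mul hX.le, Real.sqrt_mul hY.le]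
  have hsX := Real.sqrt_pos.2 hX
  have hsY := Real.sqrt_pos.2 hY
  have hsZ := Real.sqrt_pos.2 hZ
  have hYY := Real.sq_sqrt hY.le
  have : dist x z / (√X * √Z) = dist x z * Y / (√X * √Y ^ 2 * √Z) := by
    rw [hYY]; field_simp
  rw [this]
  calc dist x z * Y / (√X * √Y ^ 2 * √Z) ≤
      (dist x y * √(dist y z ^ 2 + Y * Z) + dist y z * √(dist x y ^ 2 + X * Y)) /
        (√X * √Y ^ 2 * √Z) := by gcongr
    _ = _ := by field_simp

theorem continuousOn_ballDist {n : ℕ} {x : Euc n} (hx : x ∈ unitBall n) :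
    ContinuousOn (fun y => ballDist x y) (unitBall n) := by
  intro y hy
  have hX := one_sub_norm_sq_pos hx
  have hY := one_sub_norm_sq_pos hy
  refine ContinuousAt.continuousWithinAt ?_
  unfold ballDist
  refine continuousAt_const.mul (Real.continuous_arsinh.continuousAt.comp ?_)
  refine ContinuousAt.div (by fun_prop) (by fun_prop) (Real.sqrt_pos.2 (mul_pos hX hY)).ne'

theorem arsinh_le_self {t : ℝ} (ht : 0 ≤ t) : Real.arsinh t ≤ t := by
  rw [← Real.sinh_le_sinh, Real.sinh_arsinh]
  exact Real.self_le_sinh_iff.2 ht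

theorem ballDist_le_div {n : ℕ} (x y : Euc n) :
    ballDist x y ≤ 2 * (dist x y / √((1 - ‖x‖ ^ 2) * (1 - ‖y‖ ^ 2))) :=
  mul_le_mul_of_nonneg_left (arsinh_le_self (by positivity)) zero_le_two

theorem continuous_hyperbolicDensity_comp {n : ℕ} {σ : ℝ → Euc n} (hσ : Continuous σ)
    (hG : ∀ s, σ s ∈ unitBall n) : Continuous fun s => 2 / (1 - ‖σ s‖ ^ 2) :=
  Continuous.div continuous_const (by fun_prop) fun s => (one_sub_norm_sq_pos (hG s)).ne'

/-- By the triangle inequality and arsinh v ≤ v, the right slopes of `ballDist (σ 0) (σ s)` are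
asymptotically at most the density. The comparison principle for slopes then needs no
differentiability of `σ`. -/
theorem ballDist_le_integral {n : ℕ} {σ : ℝ → Euc n} (hσ : LipschitzWith 1 σ)
    (hG : ∀ s, σ s ∈ unitBall n) {ℓ : ℝ} (hℓ : 0 ≤ ℓ) :
    ballDist (σ 0) (σ ℓ) ≤ ∫ s in (0 : ℝ)..ℓ, 2 / (1 - ‖σ s‖ ^ 2) := by
  have hw := continuous_hyperbolicDensity_comp hσ.continuous hG
  have hB : ∀ s, HasDerivAt (fun u => ∫ s in (0 : ℝ)..u, 2 / (1 - ‖σ s‖ ^ 2))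
      (2 / (1 - ‖σ s‖ ^ 2)) s := fun s => hw.integral_hasStrictDerivAt 0 s |>.hasDerivAt
  refine image_le_of_liminf_slope_right_le_deriv_boundary
    (f := fun s => ballDist (σ 0) (σ s)) (a := 0) (b := ℓ) ?_ ?_
    (fun s _ => (hB s).continuousAt.continuousWithinAt) (fun s _ => (hB s).hasDerivWithinAt) ?_
    (right_mem_Icc.2 hℓ)
  · exact (continuousOn_ballDist (hG 0)).comp hσ.continuous.continuousOn fun s _ => hG s
  · simp [ballDist_self]
  · intro s _ r hr
    have hc : Continuous fun z => 2 / √((1 - ‖σ s‖ ^ 2) * (1 - ‖σ z‖ ^ 2)) := by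
      have := hσ.continuous
      refine Continuous.div continuous_const (by fun_prop) fun z => ?_
      exact (Real.sqrt_pos.2 (mul_pos (one_sub_norm_sq_pos (hG s))
        (one_sub_norm_sq_pos (hG z)))).ne'
    have hs : 2 / √((1 - ‖σ s‖ ^ 2) * (1 - ‖σ s‖ ^ 2)) < r := by
      rwa [Real.sqrt_mul_self (one_sub_norm_sq_pos (hG s)).le]
    have hev : ∀ᶠ z in 𝓝[>] s, 2 / √((1 - ‖σ s‖ ^ 2) * (1 - ‖σ z‖ ^ 2)) < r :=
      (hc.tendsto s).mono_left nhdsWithin_le_nhds |>.eventually_lt_const hs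
    refine Eventually.frequently ?_
    filter_upwards [hev, self_mem_nhdsWithin] with z hz hsz
    have hsz : 0 < z - s := sub_pos.2 hsz
    refine lt_of_le_of_lt ?_ hz
    rw [slope_def_field, div_le_iff₀ hsz]
    have h1 := ballDist_triangle (hG 0) (hG s) (hG z)
    have h2 := ballDist_le_div (σ s) (σ z)
    have h3 : dist (σ s) (σ z) ≤ z - s := by
      have := hσ.dist_le_mul s z
      rwa [NNReal.coe_one, one_mul, dist_comm s, Real.dist_eq, abs_of_pos hsz] at this
    calc ballDist (σ 0) (σ z) - ballDist (σ 0) (σ s)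
        ≤ 2 * (dist (σ s) (σ z) / √((1 - ‖σ s‖ ^ 2) * (1 - ‖σ z‖ ^ 2))) := by linarith
      _ ≤ 2 * ((z - s) / √((1 - ‖σ s‖ ^ 2) * (1 - ‖σ z‖ ^ 2))) := by gcongr
      _ = _ := by ring

theorem ballDist_le_hyperbolicLength {n : ℕ} {x y : Euc n} {γ : ℝ → Euc n} {a b : ℝ}
    (h : IsRectifiableCurve (unitBall n) x y γ a b) : ballDist x y ≤ hyperbolicLength γ a b := by
  obtain ⟨σ, hσ, hG, hV, hI⟩ := h.exists_arcLength
  have h0 := hV a (left_mem_Icc.2 h.le)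
  have h1 := hV b (right_mem_Icc.2 h.le)
  rw [variationOnFromTo.self, h.left] at h0
  rw [variationOnFromTo_Icc_right h.le, h.right] at h1
  rw [hyperbolicLength, hI, ← h0, ← h1]
  exact ballDist_le_integral hσ hG ENNReal.toReal_nonneg

/-! ### Length of a geodesic. -/

theorem LipschitzOnWith.variationOnFromTo_le {E : Type*} [PseudoMetricSpace E] {γ : ℝ → E}
    {a b p q : ℝ} {K : NNReal} (hp : p ∈ Icc a b) (hq : q ∈ Icc a b) (hpq : p ≤ q)
    (h : LipschitzOnWith K γ (Icc p q)) : variationOnFromTo γ (Icc a b) p q ≤ K * (q - p) := by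
  have hsub : Icc p q ⊆ Icc a b := Icc_subset_Icc hp.1 hq.2
  rw [variationOnFromTo.eq_of_le _ _ hpq, inter_eq_right.2 hsub]
  have h1 := h.comp_eVariationOn_le (f := γ) (g := id) (s := Icc p q) (mapsTo_id _)
  rw [Function.comp_id, eVariationOn_id_Icc] at h1
  refine ENNReal.toReal_le_of_le_ofReal (by have := sub_nonneg.2 hpq; positivity) (h1.trans_eq ?_)
  rw [ENNReal.ofReal_mul K.coe_nonneg, ENNReal.ofReal_coe_nnreal]

theorem sinh_le_mul_cosh {u : ℝ} (hu : 0 ≤ u) : Real.sinh u ≤ u * Real.cosh u := by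
  have hmono : MonotoneOn (fun u : ℝ => u * Real.cosh u - Real.sinh u) (Ici 0) := by
    refine monotoneOn_of_deriv_nonneg (convex_Ici 0) (by fun_prop) (by fun_prop) fun v hv => ?_
    rw [interior_Ici] at hv
    have : HasDerivAt (fun u : ℝ => u * Real.cosh u - Real.sinh u)
        (1 * Real.cosh v + v * Real.sinh v - Real.cosh v) v :=
      ((hasDerivAt_id v).mul (Real.hasDerivAt_cosh v)).sub (Real.hasDerivAt_sinh v)
    rw [this.deriv]
    have := mul_nonneg (le_of_lt hv) (Real.sinh_nonneg_iff.2 (le_of_lt hv))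
    linarith
  have := hmono (mem_Ici.2 le_rfl) (mem_Ici.2 hu) hu
  simpa using this

/-- `γ` is parametrized on `[0, d]` so that the closed form of the hyperbolic distance of two of its
points is the difference of their parameters. -/
structure IsBallGeodesic {n : ℕ} (γ : ℝ → Euc n) (d : ℝ) : Prop where
  mem : ∀ t ∈ Icc 0 d, γ t ∈ unitBall n
  dist_eq : ∀ s ∈ Icc 0 d, ∀ t ∈ Icc 0 d, s ≤ t →
    dist (γ s) (γ t) = Real.sinh ((t - s) / 2) * √((1 - ‖γ s‖ ^ 2) * (1 - ‖γ t‖ ^ 2))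

namespace IsBallGeodesic

variable {n : ℕ} {γ : ℝ → Euc n} {d : ℝ}

/-- As the interval shrinks the cosh factor tends to 1, so the constant becomes `Q / 2`: the
Euclidean speed is at most half of 1-|γ|². -/
theorem lipschitzOnWith (h : IsBallGeodesic γ d) {p q : ℝ} (hp : 0 ≤ p) (hq : q ≤ d) {Q : ℝ}
    (hQ : 0 ≤ Q) (hb : ∀ t ∈ Icc p q, 1 - ‖γ t‖ ^ 2 ≤ Q) :
    LipschitzOnWith (Q * Real.cosh ((q - p) / 2) / 2).toNNReal γ (Icc p q) := by
  have hK : 0 ≤ Q * Real.cosh ((q - p) / 2) / 2 := by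
    have := Real.cosh_pos ((q - p) / 2)
    positivity
  have key : ∀ s ∈ Icc p q, ∀ t ∈ Icc p q, s ≤ t →
      dist (γ s) (γ t) ≤ Q * Real.cosh ((q - p) / 2) / 2 * (t - s) := by
    intro s hs t ht hst
    have hs' : s ∈ Icc 0 d := ⟨hp.trans hs.1, hs.2.trans hq⟩
    have ht' : t ∈ Icc 0 d := ⟨hp.trans ht.1, ht.2.trans hq⟩
    have h0 : 0 ≤ (t - s) / 2 := by linarith
    rw [h.dist_eq s hs' t ht' hst]
    have h1 : √((1 - ‖γ s‖ ^ 2) * (1 - ‖γ t‖ ^ 2)) ≤ Q := by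
      refine Real.sqrt_le_iff.2 ⟨hQ, ?_⟩
      rw [sq Q]
      exact mul_le_mul (hb s hs) (hb t ht) (one_sub_norm_sq_pos (h.mem t ht')).le hQ
    have h2 : Real.sinh ((t - s) / 2) ≤ (t - s) / 2 * Real.cosh ((q - p) / 2) := by
      refine (sinh_le_mul_cosh h0).trans (mul_le_mul_of_nonneg_left ?_ h0)
      rw [Real.cosh_le_cosh, abs_of_nonneg h0, abs_of_nonneg] <;> linarith [hs.1, ht.2]
    calc _ ≤ (t - s) / 2 * Real.cosh ((q - p) / 2) * Q :=
          mul_le_mul h2 h1 (Real.sqrt_nonneg _) (mul_nonneg h0 (Real.cosh_pos _).le)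
      _ = _ := by ring
  refine LipschitzOnWith.of_dist_le_mul fun s hs t ht => ?_
  rw [Real.coe_toNNReal _ hK]
  rcases le_total s t with hst | hst
  · rw [dist_comm s, Real.dist_eq, abs_of_nonneg (sub_nonneg.2 hst)]
    exact key s hs t ht hst
  · rw [dist_comm, Real.dist_eq, abs_of_nonneg (sub_nonneg.2 hst)]
    exact key t ht s hs hst

theorem isRectifiableCurve (h : IsBallGeodesic γ d) (hd : 0 ≤ d) :
    IsRectifiableCurve (unitBall n) (γ 0) (γ d) γ 0 d where
  le := hd
  continuousOn := (h.lipschitzOnWith le_rfl le_rfl zero_le_one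
    fun t _ => by have := sq_nonneg ‖γ t‖; linarith).continuousOn
  rectifiable := by
    have := (h.lipschitzOnWith le_rfl le_rfl zero_le_one
      fun t _ => by have := sq_nonneg ‖γ t‖; linarith).locallyBoundedVariationOn 0 d
      (left_mem_Icc.2 hd) (right_mem_Icc.2 hd)
    rwa [inter_self] at this
  mapsTo := h.mem
  left := rfl
  right := rfl

/-- One factor `κ` absorbs the change of 1-|γ|² near `θ`, the other the cosh in the Lipschitz
constant. -/
theorem eventually_variationOnFromTo_le (h : IsBallGeodesic γ d) {θ : ℝ} (hθ : θ ∈ Ico 0 d)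
    {κ : ℝ} (hκ : 1 < κ) :
    ∀ᶠ z in 𝓝[>] θ, variationOnFromTo γ (Icc 0 d) θ z ≤
      κ * (κ * ((1 - ‖γ θ‖ ^ 2) / 2)) * (z - θ) := by
  have hd : 0 ≤ d := hθ.1.trans hθ.2.le
  have hθ' : θ ∈ Icc 0 d := ⟨hθ.1, hθ.2.le⟩
  have hq := one_sub_norm_sq_pos (h.mem θ hθ')
  have hcont : ContinuousWithinAt (fun t => 1 - ‖γ t‖ ^ 2) (Ici θ) θ := by
    have h1 : ContinuousWithinAt γ (Icc 0 d) θ := (h.isRectifiableCurve hd).continuousOn θ hθ'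
    have h2 : ContinuousWithinAt γ (Ici θ) θ :=
      h1.mono_of_mem_nhdsWithin (mem_of_superset (Icc_mem_nhdsGE hθ.2)
        (Icc_subset_Icc_left hθ.1))
    exact continuousWithinAt_const.sub (h2.norm.pow 2)
  have hlt : 1 - ‖γ θ‖ ^ 2 < κ * (1 - ‖γ θ‖ ^ 2) := by nlinarith
  obtain ⟨u, hu, hus⟩ := (mem_nhdsGE_iff_exists_Icc_subset).1
    (hcont.tendsto.eventually_lt_const hlt)
  have hcosh : ∀ᶠ z in 𝓝[>] θ, Real.cosh ((z - θ) / 2) < κ := by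
    have : Continuous fun z => Real.cosh ((z - θ) / 2) := by fun_prop
    refine ((this.tendsto θ).mono_left nhdsWithin_le_nhds).eventually_lt_const ?_
    simpa using hκ
  filter_upwards [hcosh, Icc_mem_nhdsGT hu, Icc_mem_nhdsGT hθ.2] with z hz hzu hzd
  have hz' : z ∈ Icc 0 d := ⟨hθ.1.trans hzd.1, hzd.2⟩
  have hQ : 0 ≤ κ * (1 - ‖γ θ‖ ^ 2) := by positivity
  have hlip := h.lipschitzOnWith hθ.1 hzd.2 hQ fun t ht =>
    (hus ⟨ht.1, ht.2.trans hzu.2⟩ : 1 - ‖γ t‖ ^ 2 < κ * (1 - ‖γ θ‖ ^ 2)).le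
  have := hlip.variationOnFromTo_le hθ' hz' hzd.1
  have hc0 := Real.cosh_pos ((z - θ) / 2)
  rw [Real.coe_toNNReal _ (by positivity)] at this
  refine this.trans (mul_le_mul_of_nonneg_right ?_ (sub_nonneg.2 hzd.1))
  nlinarith [mul_le_mul_of_nonneg_left hz.le hQ]

theorem hyperbolicLength_le (h : IsBallGeodesic γ d) (hd : 0 ≤ d) : hyperbolicLength γ 0 d ≤ d := by
  have hγ := h.isRectifiableCurve hd
  have h0 : (0 : ℝ) ∈ Icc 0 d := left_mem_Icc.2 hd
  have hv := hγ.rectifiable.locallyBoundedVariationOn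
  obtain ⟨σ, hσ, hG, hV, hI⟩ := hγ.exists_arcLength
  rw [hyperbolicLength, hI, ← variationOnFromTo_Icc_right hd]
  set V := variationOnFromTo γ (Icc 0 d) 0 with hVdef
  have hVc : ContinuousOn V (Icc 0 d) := hγ.continuousOn.variationOnFromTo h0 hv
  have hVm : MonotoneOn V (Icc 0 d) := variationOnFromTo.monotoneOn hv h0
  have hw := continuous_hyperbolicDensity_comp hσ.continuous hG
  set F : ℝ → ℝ := fun u => ∫ s in (0 : ℝ)..u, 2 / (1 - ‖σ s‖ ^ 2) with hF
  have hFd : ∀ s, HasDerivAt F (2 / (1 - ‖σ s‖ ^ 2)) s := fun s =>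
    (hw.integral_hasStrictDerivAt 0 s).hasDerivAt
  -- The length up to parameter `s` is `F (V s)`; it stays below `s` because its right slopes are
  -- asymptotically at most 1.
  refine image_le_of_liminf_slope_right_le_deriv_boundary
    (f := fun s => F (V s)) (B := fun s => s) (B' := fun _ => 1) (a := 0) (b := d) ?_ ?_
    continuousOn_id (fun s _ => hasDerivWithinAt_id _ _) ?_ (right_mem_Icc.2 hd)
  · exact (continuous_iff_continuousAt.2 fun s => (hFd s).continuousAt).comp_continuousOn hVc
  · simp [hVdef, hF, variationOnFromTo.self]
  · intro θ hθ r hr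
    have hθ' : θ ∈ Icc 0 d := ⟨hθ.1, hθ.2.le⟩
    -- Two factors `κ` are lost in the slope of `V` and one in the slope of `F`.
    obtain ⟨κ, hκr, hκ⟩ : ∃ κ : ℝ, κ ^ 3 < r ∧ 1 < κ := by
      have hc : Continuous fun κ : ℝ => κ ^ 3 := by fun_prop
      have h1 : ∀ᶠ κ : ℝ in 𝓝[>] 1, κ ^ 3 < r :=
        ((hc.tendsto 1).mono_left nhdsWithin_le_nhds).eventually_lt_const (by simpa using hr)
      exact (h1.and self_mem_nhdsWithin).exists
    have hq := one_sub_norm_sq_pos (h.mem θ hθ')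
    have hslope : ∀ᶠ v in 𝓝 (V θ), v ≠ V θ →
        slope F (V θ) v < κ * (2 / (1 - ‖γ θ‖ ^ 2)) := by
      have h1 := (hasDerivAt_iff_tendsto_slope.1 (hFd (V θ)))
      rw [hV θ hθ'] at h1
      have h2 : 2 / (1 - ‖γ θ‖ ^ 2) < κ * (2 / (1 - ‖γ θ‖ ^ 2)) := by
        have : 0 < 2 / (1 - ‖γ θ‖ ^ 2) := by positivity
        nlinarith
      exact eventually_nhdsWithin_iff.1 (h1.eventually_lt_const h2)
    have hVt : Tendsto V (𝓝[>] θ) (𝓝 (V θ)) :=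
      ((hVc θ hθ').mono_of_mem_nhdsWithin (mem_of_superset (Icc_mem_nhdsGT hθ.2)
        (Icc_subset_Icc_left hθ.1))).tendsto
    refine Eventually.frequently ?_
    filter_upwards [hVt.eventually hslope, h.eventually_variationOnFromTo_le hθ hκ,
      self_mem_nhdsWithin, Icc_mem_nhdsGT hθ.2] with z hz1 hz2 hz3 hz4
    have hzθ : 0 < z - θ := sub_pos.2 hz3
    have hz' : z ∈ Icc 0 d := ⟨hθ.1.trans hz4.1, hz4.2⟩
    have hsub : V z - V θ = variationOnFromTo γ (Icc 0 d) θ z :=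
      variationOnFromTo.sub_right hv h0 hz' hθ'
    rw [← hsub] at hz2
    rw [slope_def_field, div_lt_iff₀ hzθ]
    have hr0 : 0 < r := by linarith
    rcases eq_or_ne (V z) (V θ) with he | hne
    · rw [he, sub_self]; positivity
    · have hpos : 0 < V z - V θ :=
        sub_pos.2 (lt_of_le_of_ne (hVm hθ' hz' hz4.1) hne.symm)
      have h1 := hz1 hne
      rw [slope_def_field, div_lt_iff₀ hpos] at h1
      calc F (V z) - F (V θ) < κ * (2 / (1 - ‖γ θ‖ ^ 2)) * (V z - V θ) := h1
        _ ≤ κ * (2 / (1 - ‖γ θ‖ ^ 2)) * (κ * (κ * ((1 - ‖γ θ‖ ^ 2) / 2)) * (z - θ)) := by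
            gcongr
        _ = κ ^ 3 * (z - θ) := by field_simp
        _ ≤ r * (z - θ) := by gcongr

end IsBallGeodesic

/-! ### Geodesics from the hyperboloid model. -/

/-- Projection of the upper sheet of the hyperboloid to the unit ball. -/
theorem norm_sq_hyperboloid_proj {n : ℕ} {p : Euc n} {a : ℝ} (ha : 0 < a)
    (hp : a ^ 2 - ‖p‖ ^ 2 = 1) : 1 - ‖(1 + a)⁻¹ • p‖ ^ 2 = 2 / (1 + a) := by
  have : ‖p‖ ^ 2 = a ^ 2 - 1 := by linarith
  have h1 : 1 + a ≠ 0 := by positivity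
  rw [norm_smul, mul_pow, this, norm_inv, Real.norm_of_nonneg (by positivity : 0 ≤ 1 + a)]
  field_simp
  ring

/-- Here `a * b - inner ℝ p q` is the cosh of the hyperbolic distance, so the first factor is the
squared sinh of half of it, as in the closed form. -/
theorem dist_sq_hyperboloid_proj {n : ℕ} {p q : Euc n} {a b : ℝ} (ha : 0 < a) (hb : 0 < b)
    (hp : a ^ 2 - ‖p‖ ^ 2 = 1) (hq : b ^ 2 - ‖q‖ ^ 2 = 1) :
    dist ((1 + a)⁻¹ • p) ((1 + b)⁻¹ • q) ^ 2 =
      (a * b - inner ℝ p q - 1) / 2 * (2 / (1 + a) * (2 / (1 + b))) := by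
  have hp' := norm_sq_hyperboloid_proj ha hp
  have hq' := norm_sq_hyperboloid_proj hb hq
  have h1 : 1 + a ≠ 0 := by positivity
  have h2 : 1 + b ≠ 0 := by positivity
  rw [dist_eq_norm, norm_sub_sq_real, real_inner_smul_left, real_inner_smul_right]
  have e1 : ‖(1 + a)⁻¹ • p‖ ^ 2 = 1 - 2 / (1 + a) := by linarith
  have e2 : ‖(1 + b)⁻¹ • q‖ ^ 2 = 1 - 2 / (1 + b) := by linarith
  rw [e1, e2]
  field_simp
  ring

/-- Any two points of the unit ball are joined by a geodesic. -/
theorem exists_isBallGeodesic {n : ℕ} {x y : Euc n} (hx : x ∈ unitBall n) (hy : y ∈ unitBall n)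
    (hxy : x ≠ y) :
    ∃ γ : ℝ → Euc n, IsBallGeodesic γ (ballDist x y) ∧ γ 0 = x ∧ γ (ballDist x y) = y := by
  have hX := one_sub_norm_sq_pos hx
  have hY := one_sub_norm_sq_pos hy
  set d := ballDist x y with hd
  have hd0 : 0 < d := by
    have : 0 < dist x y / √((1 - ‖x‖ ^ 2) * (1 - ‖y‖ ^ 2)) :=
      div_pos (dist_pos.2 hxy) (Real.sqrt_pos.2 (mul_pos hX hY))
    have := Real.arsinh_pos_iff.2 this
    rw [hd, ballDist]; linarith
  set a := (1 + ‖x‖ ^ 2) / (1 - ‖x‖ ^ 2) with ha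
  set b := (1 + ‖y‖ ^ 2) / (1 - ‖y‖ ^ 2) with hb
  set p : Euc n := (2 / (1 - ‖x‖ ^ 2)) • x with hp
  set q : Euc n := (2 / (1 - ‖y‖ ^ 2)) • y with hq
  have ha0 : 0 < a := by positivity
  have hb0 : 0 < b := by positivity
  have hap : a ^ 2 - ‖p‖ ^ 2 = 1 := by
    rw [ha, hp, norm_smul, Real.norm_of_nonneg (by positivity)]
    field_simp
    ring
  have hbq : b ^ 2 - ‖q‖ ^ 2 = 1 := by
    rw [hb, hq, norm_smul, Real.norm_of_nonneg (by positivity)]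
    field_simp
    ring
  have hpx : (1 + a)⁻¹ • p = x := by
    rw [ha, hp, smul_smul]
    convert one_smul ℝ x
    field_simp
    ring
  have hqy : (1 + b)⁻¹ • q = y := by
    rw [hb, hq, smul_smul]
    convert one_smul ℝ y
    field_simp
    ring
  have hsd : 0 < Real.sinh d := Real.sinh_pos_iff.2 hd0
  set S := Real.sinh d with hS
  set C := Real.cosh d with hC
  have hCS : C ^ 2 = S ^ 2 + 1 := Real.cosh_sq d
  have hpq : inner ℝ p q = a * b - C := by
    have h1 := dist_sq_hyperboloid_proj ha0 hb0 hap hbq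
    rw [← norm_sq_hyperboloid_proj ha0 hap, ← norm_sq_hyperboloid_proj hb0 hbq, hpx, hqy] at h1
    have h2 : Real.sinh (d / 2) ^ 2 =
        dist x y ^ 2 / ((1 - ‖x‖ ^ 2) * (1 - ‖y‖ ^ 2)) := by
      rw [hd, ballDist, mul_div_cancel_left₀ _ (two_ne_zero), Real.sinh_arsinh, div_pow,
        Real.sq_sqrt (by positivity)]
    rw [h1, mul_div_cancel_right₀ _ (by positivity)] at h2
    have h3 : C = 1 + 2 * Real.sinh (d / 2) ^ 2 := by
      rw [hC, show d = 2 * (d / 2) by ring, Real.cosh_two_mul, Real.cosh_sq]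
      ring_nf
    rw [h3, h2]
    ring
  -- The hyperbolic analogue of spherical interpolation: these coefficients trace the section of the
  -- hyperboloid by the plane of the two lifts, from `p` at 0 to `q` at `d`, with Lorentz product
  -- cosh(t-s) between parameters.
  set α : ℝ → ℝ := fun θ => Real.sinh (d - θ) / S with hα
  set β : ℝ → ℝ := fun θ => Real.sinh θ / S with hβ
  set T : ℝ → ℝ := fun θ => α θ * a + β θ * b with hT
  set P : ℝ → Euc n := fun θ => α θ • p + β θ • q with hP
  have hnp : inner ℝ p p = a ^ 2 - 1 := by rw [real_inner_self_eq_norm_sq]; linarith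
  have hnq : inner ℝ q q = b ^ 2 - 1 := by rw [real_inner_self_eq_norm_sq]; linarith
  have hTP : ∀ s t, T s * T t - inner ℝ (P s) (P t) = Real.cosh (t - s) := by
    intro s t
    simp only [hT, hP, inner_add_left, inner_add_right, real_inner_smul_left,
      real_inner_smul_right, hnp, hnq, hpq, real_inner_comm p q, hα, hβ, Real.sinh_sub,
      Real.cosh_sub]
    rw [← hS, ← hC]
    field_simp
    linear_combination (-(Real.sinh s * Real.sinh t)) * hCS
  have hTpos : ∀ t ∈ Icc 0 d, 0 < T t := by
    intro t ht
    rcases ht.2.lt_or_eq with htd | rfl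
    · have h1 : 0 < α t := div_pos (Real.sinh_pos_iff.2 (sub_pos.2 htd)) hsd
      have h2 : 0 ≤ β t := div_nonneg (Real.sinh_nonneg_iff.2 ht.1) hsd.le
      positivity
    · simpa [hT, hα, hβ, ← hS, div_self hsd.ne'] using hb0
  have hTP1 : ∀ t, T t ^ 2 - ‖P t‖ ^ 2 = 1 := by
    intro t
    rw [sq, ← real_inner_self_eq_norm_sq, hTP, sub_self, Real.cosh_zero]
  refine ⟨fun t => (1 + T t)⁻¹ • P t, ⟨?_, ?_⟩, ?_, ?_⟩
  · intro t ht
    have h1 := norm_sq_hyperboloid_proj (hTpos t ht) (hTP1 t)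
    have h2 : 0 < 2 / (1 + T t) := by have := hTpos t ht; positivity
    rw [unitBall, mem_ball_zero_iff]
    exact (sq_lt_one_iff₀ (norm_nonneg _)).1 (by linarith)
  · intro s hs t ht hst
    have h1 := dist_sq_hyperboloid_proj (hTpos s hs) (hTpos t ht) (hTP1 s) (hTP1 t)
    rw [← norm_sq_hyperboloid_proj (hTpos s hs) (hTP1 s),
      ← norm_sq_hyperboloid_proj (hTpos t ht) (hTP1 t), hTP] at h1
    have h2 : (Real.cosh (t - s) - 1) / 2 = Real.sinh ((t - s) / 2) ^ 2 := by
      rw [show t - s = 2 * ((t - s) / 2) by ring, Real.cosh_two_mul, Real.cosh_sq]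
      ring_nf
    have h3 : 0 ≤ Real.sinh ((t - s) / 2) := Real.sinh_nonneg_iff.2 (by linarith)
    rw [h2] at h1
    rw [← Real.sqrt_sq dist_nonneg, h1, Real.sqrt_mul (sq_nonneg _), Real.sqrt_sq h3]
  · simp only [hT, hP, hα, hβ, sub_zero, Real.sinh_zero, zero_div, zero_mul, zero_smul, add_zero,
      ← hS, div_self hsd.ne', one_mul, one_smul, hpx]
  · simp only [hT, hP, hα, hβ, sub_self, Real.sinh_zero, zero_div, zero_mul, zero_smul, zero_add,
      ← hS, div_self hsd.ne', one_mul, one_smul, hqy]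

theorem hyperbolicDist_eq_ballDist {n : ℕ} {x y : Euc n} (hx : x ∈ unitBall n)
    (hy : y ∈ unitBall n) : hyperbolicDist x y = ballDist x y := by
  obtain ⟨γ, h, h0, h1⟩ : ∃ γ : ℝ → Euc n, IsBallGeodesic γ (ballDist x y) ∧ γ 0 = x ∧
      γ (ballDist x y) = y := by
    rcases eq_or_ne x y with rfl | hxy
    · refine ⟨fun _ => x, ⟨fun _ _ => hx, fun s hs t ht _ => ?_⟩, rfl, rfl⟩
      rw [ballDist_self, Icc_self, mem_singleton_iff] at hs ht
      simp [hs, ht]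
    · exact exists_isBallGeodesic hx hy hxy
  have hγ := h.isRectifiableCurve (ballDist_nonneg x y)
  rw [h0, h1] at hγ
  refine IsLeast.csInf_eq ⟨⟨γ, 0, ballDist x y, hγ, ?_⟩, ?_⟩
  · exact le_antisymm (ballDist_le_hyperbolicLength hγ)
      (h.hyperbolicLength_le (ballDist_nonneg x y))
  · rintro _ ⟨γ', a, b, h', rfl⟩
    exact ballDist_le_hyperbolicLength h'

/-! ### Both kinds of balls as inequalities. -/

theorem exists_unit_smul_eq {n : ℕ} (hn : n ≠ 0) (x : Euc n) : ∃ e : Euc n, ‖e‖ = 1 ∧ x = ‖x‖ • e := by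
  have : Nonempty (Fin n) := ⟨⟨0, Nat.pos_of_ne_zero hn⟩⟩
  rcases eq_or_ne x 0 with rfl | hx
  · obtain ⟨e, he⟩ := exists_norm_eq (Euc n) zero_le_one
    exact ⟨e, he, by simp⟩
  · have h : ‖x‖ ≠ 0 := norm_ne_zero_iff.2 hx
    refine ⟨‖x‖⁻¹ • x, ?_, ?_⟩
    · rw [norm_smul, norm_inv, norm_norm, inv_mul_cancel₀ h]
    · rw [smul_smul, mul_inv_cancel₀ h, one_smul]

/-- This is where dimension at least two enters: the extremal point with |y| = |x| lies off the line
through `x`. -/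
theorem exists_unit_orthogonal {n : ℕ} (hn : 2 ≤ n) (e : Euc n) :
    ∃ f : Euc n, ‖f‖ = 1 ∧ inner ℝ e f = 0 := by
  have h : 0 < Module.finrank ℝ (ℝ ∙ e)ᗮ := by
    have h1 := Submodule.finrank_add_finrank_orthogonal (ℝ ∙ e)
    have h2 := finrank_span_le_card (R := ℝ) ({e} : Set (Euc n))
    rw [Set.toFinset_singleton, Finset.card_singleton] at h2
    rw [finrank_euclideanSpace, Fintype.card_fin] at h1
    omega
  have := Module.finrank_pos_iff.1 h
  obtain ⟨f, hf⟩ := exists_norm_eq (ℝ ∙ e)ᗮ zero_le_one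
  exact ⟨f, hf, Submodule.mem_orthogonal_singleton_iff_inner_right.1 f.2⟩

theorem infDist_frontier_unitBall {n : ℕ} (hn : n ≠ 0) {x : Euc n} (hx : x ∈ unitBall n) :
    Metric.infDist x (frontier (unitBall n)) = 1 - ‖x‖ := by
  have hx1 : ‖x‖ < 1 := by simpa [unitBall] using hx
  rw [unitBall, frontier_ball _ one_ne_zero]
  obtain ⟨e, he, hxe⟩ := exists_unit_smul_eq hn x
  have hmem : e ∈ Metric.sphere (0 : Euc n) 1 := by simpa using he
  apply le_antisymm
  · refine (Metric.infDist_le_dist_of_mem hmem).trans_eq ?_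
    rw [dist_comm, dist_eq_norm]
    nth_rewrite 1 [hxe]
    rw [show e - ‖x‖ • e = (1 - ‖x‖) • e by rw [sub_smul, one_smul], norm_smul, he, mul_one,
      Real.norm_of_nonneg (by linarith)]
  · refine (Metric.le_infDist ⟨e, hmem⟩).2 fun y hy => ?_
    rw [mem_sphere_zero_iff_norm] at hy
    rw [← hy, dist_comm, dist_eq_norm]
    exact norm_sub_norm_le y x

theorem mem_jBall_iff {n : ℕ} (hn : n ≠ 0) {x y : Euc n} (hx : x ∈ unitBall n) {r : ℝ} :
    y ∈ jBall x r ↔ y ∈ unitBall n ∧ dist x y < (Real.exp r - 1) * (1 - ‖x‖) ∧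
      dist x y < (Real.exp r - 1) * (1 - ‖y‖) := by
  refine and_congr_right fun hy => ?_
  have hx1 : ‖x‖ < 1 := by simpa [unitBall] using hx
  have hy1 : ‖y‖ < 1 := by simpa [unitBall] using hy
  have hpos : 0 < min (1 - ‖x‖) (1 - ‖y‖) := lt_min (by linarith) (by linarith)
  rw [distanceRatioDist, infDist_frontier_unitBall hn hx, infDist_frontier_unitBall hn hy,
    Real.log_lt_iff_lt_exp (by positivity), ← lt_sub_iff_add_lt', div_lt_iff₀ hpos]
  rcases le_total (1 - ‖x‖) (1 - ‖y‖) with h | h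
  · rw [min_eq_left h]
    refine ⟨fun h1 => ⟨h1, ?_⟩, fun h1 => h1.1⟩
    have : 0 < Real.exp r - 1 := by
      by_contra hc
      have := dist_nonneg (x := x) (y := y)
      nlinarith
    exact h1.trans_le (mul_le_mul_of_nonneg_left h this.le)
  · rw [min_eq_right h]
    refine ⟨fun h1 => ⟨?_, h1⟩, fun h1 => h1.2⟩
    have : 0 < Real.exp r - 1 := by
      by_contra hc
      have := dist_nonneg (x := x) (y := y)
      nlinarith
    exact h1.trans_le (mul_le_mul_of_nonneg_left h this.le)

theorem mem_rhoBall_iff {n : ℕ} {x y : Euc n} (hx : x ∈ unitBall n) {s : ℝ} :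
    y ∈ rhoBall x s ↔ y ∈ unitBall n ∧ ballDist x y < s :=
  and_congr_right fun hy => by rw [hyperbolicDist_eq_ballDist hx hy]

theorem sq_div_sqrt_one_sub_norm_sq {n : ℕ} {x y : Euc n} (hx : x ∈ unitBall n)
    (hy : y ∈ unitBall n) :
    (dist x y / √((1 - ‖x‖ ^ 2) * (1 - ‖y‖ ^ 2))) ^ 2 =
      dist x y ^ 2 / ((1 - ‖x‖ ^ 2) * (1 - ‖y‖ ^ 2)) := by
  have hX := one_sub_norm_sq_pos hx
  have hY := one_sub_norm_sq_pos hy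
  rw [div_pow, Real.sq_sqrt (by positivity)]

theorem ballDist_lt_two_mul_arsinh_iff {n : ℕ} {x y : Euc n} (hx : x ∈ unitBall n)
    (hy : y ∈ unitBall n) {k : ℝ} (hk : 0 ≤ k) :
    ballDist x y < 2 * Real.arsinh k ↔
      dist x y ^ 2 < k ^ 2 * ((1 - ‖x‖ ^ 2) * (1 - ‖y‖ ^ 2)) := by
  have hX := one_sub_norm_sq_pos hx
  have hY := one_sub_norm_sq_pos hy
  rw [ballDist, mul_lt_mul_iff_right₀ two_pos, Real.arsinh_lt_arsinh,
    ← pow_lt_pow_iff_left₀ (by positivity) hk two_ne_zero, sq_div_sqrt_one_sub_norm_sq hx hy,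
    div_lt_iff₀ (by positivity)]

theorem ballDist_eq_two_mul_arsinh {n : ℕ} {x y : Euc n} (hx : x ∈ unitBall n)
    (hy : y ∈ unitBall n) {k : ℝ} (hk : 0 ≤ k)
    (h : dist x y ^ 2 = k ^ 2 * ((1 - ‖x‖ ^ 2) * (1 - ‖y‖ ^ 2))) :
    ballDist x y = 2 * Real.arsinh k := by
  have hX := one_sub_norm_sq_pos hx
  have hY := one_sub_norm_sq_pos hy
  have e : dist x y / √((1 - ‖x‖ ^ 2) * (1 - ‖y‖ ^ 2)) = k := by
    refine (pow_left_inj₀ (by positivity) hk two_ne_zero).1 ?_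
    rw [sq_div_sqrt_one_sub_norm_sq hx hy, h, mul_div_cancel_right₀ _ (by positivity)]
  rw [ballDist, e]

/-- The identity sinh²(½ log E) = (E-1)²/(4E) brings logarithmic radii to the form of the
closed-form distance. -/
theorem log_eq_two_mul_arsinh {E k : ℝ} (hE : 1 ≤ E) (hk : 0 ≤ k)
    (h : k ^ 2 * (4 * E) = (E - 1) ^ 2) : Real.log E = 2 * Real.arsinh k := by
  have hE0 : 0 < E := by linarith
  have h1 : Real.sinh (Real.log E / 2) = k := by
    have hs : 0 ≤ Real.sinh (Real.log E / 2) :=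
      Real.sinh_nonneg_iff.2 (by have := Real.log_nonneg hE; linarith)
    refine (pow_left_inj₀ hs hk two_ne_zero).1 ?_
    have h2 : Real.cosh (Real.log E) = 1 + 2 * Real.sinh (Real.log E / 2) ^ 2 := by
      conv_lhs => rw [show Real.log E = 2 * (Real.log E / 2) by ring]
      rw [Real.cosh_two_mul, Real.cosh_sq]
      ring
    rw [Real.cosh_log hE0] at h2
    have h3 : Real.sinh (Real.log E / 2) ^ 2 = ((E + E⁻¹) / 2 - 1) / 2 := by linarith
    rw [h3, eq_comm, ← mul_left_inj' (show 4 * E ≠ 0 by positivity), h]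
    field_simp
    ring
  rw [← h1, Real.arsinh_sinh]
  ring

/-! ### The radii and the scalar inequalities. -/

section Radii

variable {t c : ℝ}

theorem log_inner_eq_arsinh (ht : 0 ≤ t) (hc : 0 < c) :
    Real.log (1 + 2 * c / (1 + t)) = 2 * Real.arsinh (c / √((1 + t) * (1 + t + 2 * c))) := by
  refine log_eq_two_mul_arsinh ?_ (by positivity) ?_
  · have : 0 ≤ 2 * c / (1 + t) := by positivity
    linarith
  · rw [div_pow, Real.sq_sqrt (by positivity)]
    field_simp
    ring

theorem log_outer_eq_arsinh (ht1 : t < 1) (hc : 0 < c) :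
    Real.log ((1 + 2 * c - t) / (1 - t)) =
      2 * Real.arsinh (c / √((1 - t) * (1 + 2 * c - t))) := by
  have h1 : 0 < 1 - t := by linarith
  have h2 : 0 < 1 + 2 * c - t := by linarith
  refine log_eq_two_mul_arsinh ?_ (by positivity) ?_
  · rw [le_div_iff₀ h1]; linarith
  · rw [div_pow, Real.sq_sqrt (by positivity)]
    obtain ⟨w, hw⟩ : ∃ w, w = 1 + 2 * c - t := ⟨_, rfl⟩
    rw [← hw] at h2 ⊢
    field_simp
    rw [hw]
    ring

variable {s u : ℝ}

/-- The hypothesis persists when `u` is lowered. If a conclusion failed, `u` could be lowered to the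
larger of |s-t| and the violated bound, where the hypothesis is false. -/
theorem lt_of_sq_lt_inner (ht : 0 ≤ t) (ht1 : t < 1) (hs1 : s < 1) (hc : 0 < c)
    (hst : |s - t| ≤ u) (h : u ^ 2 * (1 + t + 2 * c) < c ^ 2 * (1 - t) * (1 - s ^ 2)) :
    u < c * (1 - t) ∧ u < c * (1 - s) := by
  obtain ⟨h1, h2⟩ := abs_le.1 hst
  have hp : 0 < 1 - t := by linarith
  have hq : 0 < 1 - s := by linarith
  have hcp : 0 < c * (1 - t) := mul_pos hc hp
  have hcq : 0 < c * (1 - s) := mul_pos hc hq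
  have hA : 0 < 1 + t + 2 * c := by positivity
  have mono : ∀ v, 0 ≤ v → v ≤ u → v ^ 2 * (1 + t + 2 * c) < c ^ 2 * (1 - t) * (1 - s ^ 2) :=
    fun v hv hvu => lt_of_le_of_lt
      (mul_le_mul_of_nonneg_right (pow_le_pow_left₀ hv hvu 2) hA.le) h
  have second : u < c * (1 - s) := by
    by_contra! hu
    rcases le_total (s - t) (c * (1 - s)) with hw | hw
    · have := mono _ hcq.le hu
      have h3 : 0 ≤ c ^ 2 * (1 - s) * ((1 - s) * (1 + t + 2 * c) - (1 - t) * (1 + s)) := by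
        refine mul_nonneg (by positivity) ?_
        linarith
      linarith
    · have hw0 : 0 < s - t := hcq.trans_le hw
      have := mono _ hw0.le (by linarith)
      have h3 : (c * (1 - s)) ^ 2 * (1 + t) ≤ (s - t) ^ 2 * (1 + t) := by gcongr
      have h4 : 2 * c * ((c * (1 - s)) * (s - t)) ≤ 2 * c * ((s - t) * (s - t)) := by gcongr
      linarith
  refine ⟨?_, second⟩
  rcases le_total t s with hts | hts
  · exact second.trans_le (by gcongr)
  · by_contra! hu
    rcases le_total (t - s) (c * (1 - t)) with hw | hw
    · have := mono _ hcp.le hu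
      have h3 : 0 ≤ c ^ 2 * (1 - t) * ((1 - t) * (1 + t + 2 * c) - (1 - s ^ 2)) := by
        refine mul_nonneg (by positivity) ?_
        nlinarith [mul_nonneg (sub_nonneg.2 hts) (show 0 ≤ 2 - t - s by linarith)]
      linarith
    · have hw0 : 0 < t - s := hcp.trans_le hw
      have := mono _ hw0.le (by linarith)
      have h3 : (c * (1 - t)) ^ 2 * (1 + t) ≤ (t - s) ^ 2 * (1 + t) := by gcongr
      have h4 : 2 * c * ((c * (1 - t)) * (t - s)) ≤ 2 * c * ((t - s) * (t - s)) := by gcongr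
      have h5 : 0 ≤ c ^ 2 * (1 - t) * (t - s) * (2 - t - s) :=
        mul_nonneg (by positivity) (by linarith)
      linarith

theorem sq_lt_of_lt_outer_arsinh (ht : 0 ≤ t) (ht1 : t < 1) (hs : 0 ≤ s) (hs1 : s < 1)
    (hu : 0 ≤ u) (h1 : u < c * (1 - t)) (h2 : u < c * (1 - s)) :
    u ^ 2 * (1 + t) < c ^ 2 * (1 - t) * (1 - s ^ 2) := by
  have hp : 0 < 1 - t := by linarith
  have hq : 0 < 1 - s := by linarith
  rcases le_total t s with hts | hts
  · have h3 := mul_lt_mul_of_pos_right (pow_lt_pow_left₀ h2 hu two_ne_zero)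
      (show 0 < 1 + t by linarith)
    have h4 : 0 ≤ c ^ 2 * (1 - s) * ((1 - t) * (1 + s) - (1 - s) * (1 + t)) := by
      refine mul_nonneg (by positivity) ?_
      linarith
    linarith
  · have h3 := mul_lt_mul_of_pos_right (pow_lt_pow_left₀ h1 hu two_ne_zero)
      (show 0 < 1 + t by linarith)
    have h4 : 0 ≤ c ^ 2 * (1 - t) * (t ^ 2 - s ^ 2) :=
      mul_nonneg (by positivity) (sub_nonneg.2 (by gcongr))
    linarith

/-- The smaller of the bounds c(1-s) and t+s on `u` suffices; they coincide at the extremal point on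
the opposite radius. -/
theorem sq_lt_of_lt_outer_log (ht : 0 ≤ t) (ht1 : t < 1) (hs : 0 ≤ s) (hs1 : s < 1) (hc : 0 < c)
    (hu : 0 ≤ u) (hst : u ≤ t + s) (h : u < c * (1 - s)) :
    u ^ 2 * (1 + 2 * c - t) < c ^ 2 * (1 + t) * (1 - s ^ 2) := by
  have hp : 0 < 1 - t := by linarith
  have hq : 0 < 1 - s := by linarith
  have hA : 0 < 1 + 2 * c - t := by linarith
  rcases le_or_gt (c * (1 - s)) (t + s) with hw | hw
  · have h3 := mul_lt_mul_of_pos_right (pow_lt_pow_left₀ h hu two_ne_zero) hA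
    have h4 : 0 ≤ c ^ 2 * (1 - s) * ((1 + t) * (1 + s) - (1 - s) * (1 + 2 * c - t)) := by
      refine mul_nonneg (by positivity) ?_
      linarith
    linarith
  · have h0 : 0 ≤ t + s := by positivity
    have h2 : u ^ 2 * (1 + 2 * c - t) ≤ (t + s) ^ 2 * (1 + 2 * c - t) := by gcongr
    have h3 := mul_lt_mul_of_pos_right (pow_lt_pow_left₀ hw h0 two_ne_zero) hp
    have h4 : 2 * c * ((t + s) * (t + s)) ≤ 2 * c * (c * (1 - s) * (t + s)) := by gcongr
    linarith

end Radii

/-! ### The two inclusions. -/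

theorem norm_lt_one_of_mem_unitBall {n : ℕ} {x : Euc n} (hx : x ∈ unitBall n) : ‖x‖ < 1 := by
  simpa [unitBall] using hx

theorem innerRadius_eq_arsinh {n : ℕ} (x : Euc n) {r : ℝ} (hr : 0 < r) :
    innerRadius x r = 2 * Real.arsinh
      ((Real.exp r - 1) / √((1 + ‖x‖) * (1 + ‖x‖ + 2 * (Real.exp r - 1)))) :=
  log_inner_eq_arsinh (norm_nonneg x) (sub_pos.2 (Real.one_lt_exp_iff.2 hr))

theorem outerRadius_eq_arsinh {n : ℕ} {x : Euc n} (hx : x ∈ unitBall n) {r : ℝ} (hr : 0 < r) :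
    outerRadius x r = min (2 * Real.arsinh ((Real.exp r - 1) / (1 + ‖x‖)))
      (2 * Real.arsinh ((Real.exp r - 1) /
        √((1 - ‖x‖) * (1 + 2 * (Real.exp r - 1) - ‖x‖)))) := by
  rw [← log_outer_eq_arsinh (norm_lt_one_of_mem_unitBall hx)
    (sub_pos.2 (Real.one_lt_exp_iff.2 hr)), outerRadius]
  ring_nf

theorem rhoBall_innerRadius_subset {n : ℕ} (hn : n ≠ 0) {x : Euc n} (hx : x ∈ unitBall n) {r : ℝ}
    (hr : 0 < r) : rhoBall x (innerRadius x r) ⊆ jBall x r := by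
  intro y hy
  have hc : 0 < Real.exp r - 1 := sub_pos.2 (Real.one_lt_exp_iff.2 hr)
  have ht := norm_nonneg x
  rw [mem_rhoBall_iff hx, innerRadius_eq_arsinh x hr] at hy
  obtain ⟨hyb, hy⟩ := hy
  rw [ballDist_lt_two_mul_arsinh_iff hx hyb (by positivity), div_pow,
    Real.sq_sqrt (by positivity)] at hy
  refine (mem_jBall_iff hn hx).2 ⟨hyb, ?_⟩
  refine lt_of_sq_lt_inner ht (norm_lt_one_of_mem_unitBall hx) (norm_lt_one_of_mem_unitBall hyb) hc
    (u := dist x y) ?_ ?_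
  · rw [dist_comm, dist_eq_norm]
    exact abs_norm_sub_norm_le y x
  · have hA : 0 < 1 + ‖x‖ + 2 * (Real.exp r - 1) := by positivity
    calc _ < _ := mul_lt_mul_of_pos_right hy hA
      _ = _ := by field_simp; ring

theorem jBall_subset_rhoBall_outerRadius {n : ℕ} (hn : n ≠ 0) {x : Euc n} (hx : x ∈ unitBall n)
    {r : ℝ} (hr : 0 < r) : jBall x r ⊆ rhoBall x (outerRadius x r) := by
  intro y hy
  have hc : 0 < Real.exp r - 1 := sub_pos.2 (Real.one_lt_exp_iff.2 hr)
  have ht := norm_nonneg x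
  have ht1 := norm_lt_one_of_mem_unitBall hx
  obtain ⟨hyb, hy1, hy2⟩ := (mem_jBall_iff hn hx).1 hy
  have hs1 := norm_lt_one_of_mem_unitBall hyb
  have hp : 0 < 1 - ‖x‖ := by linarith
  rw [mem_rhoBall_iff hx, outerRadius_eq_arsinh hx hr, lt_min_iff]
  refine ⟨hyb, ?_, ?_⟩
  · rw [ballDist_lt_two_mul_arsinh_iff hx hyb (by positivity)]
    have := sq_lt_of_lt_outer_arsinh ht ht1 (norm_nonneg y) hs1 dist_nonneg hy1 hy2
    refine lt_of_mul_lt_mul_right (this.trans_eq ?_) (show 0 ≤ 1 + ‖x‖ by positivity)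
    field_simp
    ring
  · have hA : 0 < 1 + 2 * (Real.exp r - 1) - ‖x‖ := by linarith
    rw [ballDist_lt_two_mul_arsinh_iff hx hyb (by positivity), div_pow,
      Real.sq_sqrt (by positivity)]
    have := sq_lt_of_lt_outer_log ht ht1 (norm_nonneg y) hs1 hc dist_nonneg
      (by rw [dist_eq_norm]; exact norm_sub_le x y) hy2
    obtain ⟨w, hw⟩ : ∃ w, w = 1 + 2 * (Real.exp r - 1) - ‖x‖ := ⟨_, rfl⟩
    rw [← hw] at hA this ⊢
    refine lt_of_mul_lt_mul_right (this.trans_eq ?_) hA.le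
    field_simp
    ring

/-! ### Sharpness. -/

theorem le_innerRadius_of_subset {n : ℕ} (hn : n ≠ 0) {x : Euc n} (hx : x ∈ unitBall n) {r s : ℝ}
    (hr : 0 < r) (h : rhoBall x s ⊆ jBall x r) : s ≤ innerRadius x r := by
  by_contra! hlt
  have hc : 0 < Real.exp r - 1 := sub_pos.2 (Real.one_lt_exp_iff.2 hr)
  have ht := norm_nonneg x
  have ht1 := norm_lt_one_of_mem_unitBall hx
  obtain ⟨e, he, hxe⟩ := exists_unit_smul_eq hn x
  rw [innerRadius_eq_arsinh x hr] at hlt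
  set c := Real.exp r - 1 with hcdef
  -- The solution of s-t = c(1-s): the point sits on the boundary of the j-ball, at hyperbolic
  -- distance exactly `m`.
  set s₁ := (‖x‖ + c) / (1 + c) with hs
  have hs0 : 0 ≤ s₁ := by positivity
  have hs1 : s₁ < 1 := by rw [hs, div_lt_one (by positivity)]; linarith
  have hsc : s₁ - ‖x‖ = c * (1 - s₁) := by rw [hs]; field_simp; ring
  have hny : ‖s₁ • e‖ = s₁ := by rw [norm_smul, he, mul_one, Real.norm_of_nonneg hs0]
  have hyb : s₁ • e ∈ unitBall n := by rw [unitBall, mem_ball_zero_iff, hny]; exact hs1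
  have hd : dist x (s₁ • e) = s₁ - ‖x‖ := by
    rw [dist_comm, dist_eq_norm]
    nth_rewrite 1 [hxe]
    rw [← sub_smul, norm_smul, he, mul_one, Real.norm_of_nonneg]
    rw [hsc]
    exact mul_nonneg hc.le (by linarith)
  have hD : ballDist x (s₁ • e) = 2 * Real.arsinh (c / √((1 + ‖x‖) * (1 + ‖x‖ + 2 * c))) := by
    refine ballDist_eq_two_mul_arsinh hx hyb (by positivity) ?_
    rw [hny, hd, hsc, div_pow, Real.sq_sqrt (by positivity), hs]
    field_simp
    ring
  have := ((mem_jBall_iff hn hx).1 (h ((mem_rhoBall_iff hx).2 ⟨hyb, hD.trans_lt hlt⟩))).2.2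
  rw [hny, hd, hsc] at this
  exact lt_irrefl _ this

/-- Extremal points satisfy the j-ball conditions only with ≤. By convexity of the norm the open
segment from `x` to `y` satisfies them strictly, and the bound passes to the endpoint by continuity.
-/
theorem ballDist_le_of_jBall_subset {n : ℕ} (hn : n ≠ 0) {x y : Euc n} (hx : x ∈ unitBall n)
    (hy : y ∈ unitBall n) {r s : ℝ} (hr : 0 < r) (h : jBall x r ⊆ rhoBall x s)
    (h1 : dist x y ≤ (Real.exp r - 1) * (1 - ‖x‖))
    (h2 : dist x y ≤ (Real.exp r - 1) * (1 - ‖y‖)) : ballDist x y ≤ s := by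
  have hc : 0 < Real.exp r - 1 := sub_pos.2 (Real.one_lt_exp_iff.2 hr)
  have hx1 := norm_lt_one_of_mem_unitBall hx
  set c := Real.exp r - 1 with hcdef
  have hconv : Convex ℝ (unitBall n) := convex_ball _ _
  have hmem : ∀ l ∈ Icc (0 : ℝ) 1, AffineMap.lineMap x y l ∈ unitBall n := fun l hl =>
    hconv.lineMap_mem hx hy hl
  have hlt : ∀ l ∈ Ioo (0 : ℝ) 1, ballDist x (AffineMap.lineMap x y l) < s := by
    intro l hl
    have hlb := hmem l ⟨hl.1.le, hl.2.le⟩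
    have hd : dist x (AffineMap.lineMap x y l) = l * dist x y := by
      rw [dist_left_lineMap, Real.norm_of_nonneg hl.1.le]
    have hnorm : ‖(AffineMap.lineMap x y l : Euc n)‖ ≤ (1 - l) * ‖x‖ + l * ‖y‖ := by
      rw [AffineMap.lineMap_apply_module]
      refine (norm_add_le _ _).trans_eq ?_
      rw [norm_smul, norm_smul, Real.norm_of_nonneg (by linarith [hl.2]),
        Real.norm_of_nonneg hl.1.le]
    have hp : 0 < (1 - l) * (c * (1 - ‖x‖)) :=
      mul_pos (by linarith [hl.2]) (mul_pos hc (by linarith))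
    refine ((mem_rhoBall_iff hx).1 (h ((mem_jBall_iff hn hx).2 ⟨hlb, ?_, ?_⟩))).2
    · rw [hd]
      have := mul_le_mul_of_nonneg_left h1 hl.1.le
      linarith
    · rw [hd]
      have h3 := mul_le_mul_of_nonneg_left h2 hl.1.le
      have h4 := mul_le_mul_of_nonneg_left hnorm hc.le
      linarith
  have hcont : ContinuousWithinAt (fun l : ℝ => ballDist x (AffineMap.lineMap x y l)) (Ioo 0 1) 1 := by
    have hl : ContinuousOn (fun l : ℝ => (AffineMap.lineMap x y l : Euc n)) (Icc 0 1) :=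
      AffineMap.lineMap_continuous.continuousOn
    exact ((continuousOn_ballDist hx).comp hl hmem 1 (right_mem_Icc.2 zero_le_one)).mono
      Ioo_subset_Icc_self
  have hne : (𝓝[Ioo (0 : ℝ) 1] 1).NeBot := by
    rw [nhdsWithin_Ioo_eq_nhdsLT zero_lt_one]; infer_instance
  have := le_of_tendsto hcont.tendsto
    (eventually_nhdsWithin_of_forall fun l hl => (hlt l hl).le)
  rwa [AffineMap.lineMap_apply_one] at this

theorem outerRadius_le_of_subset {n : ℕ} (hn : 2 ≤ n) {x : Euc n} (hx : x ∈ unitBall n) {r s : ℝ}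
    (hr : 0 < r) (h : jBall x r ⊆ rhoBall x s) : outerRadius x r ≤ s := by
  have hn0 : n ≠ 0 := by omega
  have hc : 0 < Real.exp r - 1 := sub_pos.2 (Real.one_lt_exp_iff.2 hr)
  have ht := norm_nonneg x
  have ht1 := norm_lt_one_of_mem_unitBall hx
  have hp : 0 < 1 - ‖x‖ := by linarith
  obtain ⟨e, he, hxe⟩ := exists_unit_smul_eq hn0 x
  rw [outerRadius_eq_arsinh hx hr]
  have key := fun (y : Euc n) hy => ballDist_le_of_jBall_subset hn0 (y := y) hx hy hr h
  set c := Real.exp r - 1 with hcdef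
  -- The condition says that the solution of t+s = c(1-s) has s ≥ t, so that the constraint at `y`
  -- is the binding one.
  rcases le_or_gt (2 * ‖x‖) (c * (1 - ‖x‖)) with htc | htc
  · refine (min_le_right _ _).trans ?_
    set s₀ := (c - ‖x‖) / (1 + c) with hs
    have hts : ‖x‖ ≤ s₀ := by rw [hs, le_div_iff₀ (by positivity)]; linarith
    have hs0 : 0 ≤ s₀ := ht.trans hts
    have hs1 : s₀ < 1 := by rw [hs, div_lt_one (by positivity)]; linarith
    have hsc : ‖x‖ + s₀ = c * (1 - s₀) := by rw [hs]; field_simp; ring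
    have hny : ‖(-s₀) • e‖ = s₀ := by
      rw [norm_smul, he, mul_one, norm_neg, Real.norm_of_nonneg hs0]
    have hyb : (-s₀) • e ∈ unitBall n := by rw [unitBall, mem_ball_zero_iff, hny]; exact hs1
    have hd : dist x ((-s₀) • e) = c * (1 - s₀) := by
      rw [dist_eq_norm]
      nth_rewrite 1 [hxe]
      rw [← sub_smul, norm_smul, he, mul_one, sub_neg_eq_add, Real.norm_of_nonneg (by positivity),
        hsc]
    have hA : 0 < 1 + 2 * c - ‖x‖ := by linarith
    have hD : ballDist x ((-s₀) • e) =
        2 * Real.arsinh (c / √((1 - ‖x‖) * (1 + 2 * c - ‖x‖))) := by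
      refine ballDist_eq_two_mul_arsinh hx hyb (by positivity) ?_
      have e1 : 1 + s₀ = (1 + 2 * c - ‖x‖) / (1 + c) := by rw [hs]; field_simp; ring
      have e2 : 1 - s₀ = (1 + ‖x‖) / (1 + c) := by rw [hs]; field_simp; ring
      rw [hny, hd, div_pow, Real.sq_sqrt (by positivity),
        show 1 - s₀ ^ 2 = (1 - s₀) * (1 + s₀) by ring, e1, e2]
      obtain ⟨w, hw⟩ : ∃ w, w = 1 + 2 * c - ‖x‖ := ⟨_, rfl⟩
      rw [← hw] at hA ⊢
      field_simp
      ring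
    rw [← hD]
    refine key _ hyb ?_ ?_
    · rw [hd]; gcongr
    · rw [hd, hny]
  · refine (min_le_left _ _).trans ?_
    have ht0 : 0 < ‖x‖ := by
      have : 0 < c * (1 - ‖x‖) := mul_pos hc hp
      linarith
    obtain ⟨f, hf, hef⟩ := exists_unit_orthogonal hn e
    set t := ‖x‖ with htdef
    set u := c * (1 - t) with hu
    have hu0 : 0 < u := mul_pos hc hp
    -- The cosine, by the law of cosines, of the angle at the origin for which two points of norm
    -- `t` are at distance `u`; u < 2t makes it admissible.
    set C := 1 - u ^ 2 / (2 * t ^ 2) with hC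
    have hC1 : C ≤ 1 := by
      have : 0 ≤ u ^ 2 / (2 * t ^ 2) := by positivity
      linarith
    have hC2 : -1 ≤ C := by
      have : u ^ 2 / (2 * t ^ 2) ≤ 2 := by
        rw [div_le_iff₀ (by positivity)]
        nlinarith
      linarith
    set S := √(1 - C ^ 2) with hS
    have hCS : S ^ 2 = 1 - C ^ 2 := Real.sq_sqrt (by nlinarith)
    have hnab : ∀ a b : ℝ, ‖a • e + b • f‖ ^ 2 = a ^ 2 + b ^ 2 := by
      intro a b
      rw [norm_add_sq_real, norm_smul, norm_smul, real_inner_smul_left, real_inner_smul_right, hef,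
        he, hf]
      simp
    set y : Euc n := (t * C) • e + (t * S) • f with hy
    have hny : ‖y‖ = t := by
      refine (pow_left_inj₀ (norm_nonneg _) ht two_ne_zero).1 ?_
      rw [hy, hnab, mul_pow, mul_pow, hCS]
      ring
    have hyb : y ∈ unitBall n := by rw [unitBall, mem_ball_zero_iff, hny]; exact ht1
    have hd : dist x y = u := by
      refine (pow_left_inj₀ dist_nonneg hu0.le two_ne_zero).1 ?_
      have e1 : y - x = (t * C - t) • e + (t * S) • f := by
        conv_lhs => rw [hxe, hy]
        module
      rw [dist_comm, dist_eq_norm, e1, hnab, mul_pow, hCS, hC]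
      field_simp
      ring
    have hD : ballDist x y = 2 * Real.arsinh (c / (1 + t)) := by
      refine ballDist_eq_two_mul_arsinh hx hyb (by positivity) ?_
      rw [hny, hd, ← htdef, hu]
      field_simp
      ring
    rw [← hD]
    refine key _ hyb ?_ ?_
    · rw [hd]
    · rw [hd, hny]

/-! ### The limit of the ratio of the radii. -/

theorem HasDerivAt.tendsto_div_nhdsGT_zero {f : ℝ → ℝ} {f' : ℝ} (hf : HasDerivAt f f' 0)
    (h0 : f 0 = 0) : Tendsto (fun r => f r / r) (𝓝[>] 0) (𝓝 f') := by
  have := hf.tendsto_slope_zero_right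
  refine this.congr fun r => ?_
  rw [zero_add, h0, sub_zero, smul_eq_mul, div_eq_inv_mul]

theorem tendsto_outerRadius_div_innerRadius {n : ℕ} {x : Euc n} (hx : x ∈ unitBall n) :
    Tendsto (fun r : ℝ => outerRadius x r / innerRadius x r) (𝓝[>] 0) (𝓝 1) := by
  have ht := norm_nonneg x
  have ht1 := norm_lt_one_of_mem_unitBall hx
  have hp : 0 < 1 - ‖x‖ := by linarith
  have hexp : HasDerivAt Real.exp 1 0 := by simpa using Real.hasDerivAt_exp 0
  have hm : HasDerivAt (fun r => innerRadius x r) (2 / (1 + ‖x‖)) 0 := by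
    have h1 := ((((hexp.sub_const 1).const_mul 2).div_const (1 + ‖x‖)).const_add 1).log (by simp)
    simpa [innerRadius] using h1
  have hM1 : HasDerivAt (fun r => 2 * Real.arsinh ((Real.exp r - 1) / (1 + ‖x‖)))
      (2 / (1 + ‖x‖)) 0 := by
    have h1 := (((hexp.sub_const 1).div_const (1 + ‖x‖)).arsinh).const_mul 2
    simpa [div_eq_mul_inv] using h1
  have hM2 : HasDerivAt (fun r => Real.log ((2 * Real.exp r - 1 - ‖x‖) / (1 - ‖x‖)))
      (2 / (1 - ‖x‖)) 0 := by
    have e : (2 * Real.exp 0 - 1 - ‖x‖) / (1 - ‖x‖) = 1 := by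
      rw [Real.exp_zero, div_eq_one_iff_eq hp.ne']; ring
    have h1 := ((((hexp.const_mul 2).sub_const 1).sub_const ‖x‖).div_const (1 - ‖x‖)).log
      (by rw [e]; exact one_ne_zero)
    rwa [e, div_one, mul_one] at h1
  have hm' := hm.tendsto_div_nhdsGT_zero (by simp [innerRadius])
  have hM1' := hM1.tendsto_div_nhdsGT_zero (by simp)
  have hM2' := hM2.tendsto_div_nhdsGT_zero (by
    rw [Real.exp_zero, show (2 : ℝ) * 1 - 1 - ‖x‖ = 1 - ‖x‖ by ring, div_self hp.ne', Real.log_one])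
  -- Dividing both radii by `r` turns the ratio into one of slopes at 0; the logarithmic term has
  -- slope 2/(1-t) ≥ 2/(1+t), so it does not affect the minimum of the limits.
  have hlim := (hM1'.min hM2').div hm' (by positivity)
  have hmin : min (2 / (1 + ‖x‖)) (2 / (1 - ‖x‖)) = 2 / (1 + ‖x‖) := by
    refine min_eq_left ?_
    gcongr
    linarith
  rw [hmin, div_self (by positivity)] at hlim
  refine hlim.congr' ?_
  filter_upwards [self_mem_nhdsWithin] with r hr
  have hr : 0 < r := hr
  simp only [Pi.div_apply]
  rw [min_div_div_right hr.le, div_div_div_cancel_right₀ hr.ne', outerRadius]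

theorem corollary3p2 (n : ℕ) (hn : 2 ≤ n) (x : Euc n) (hx : x ∈ unitBall n) :
    (∀ r : ℝ, 0 < r →
      rhoBall x (innerRadius x r) ⊆ jBall x r ∧
      jBall x r ⊆ rhoBall x (outerRadius x r) ∧
      (∀ s : ℝ, rhoBall x s ⊆ jBall x r → s ≤ innerRadius x r) ∧
      (∀ s : ℝ, jBall x r ⊆ rhoBall x s → outerRadius x r ≤ s)) ∧
    Filter.Tendsto (fun r : ℝ => outerRadius x r / innerRadius x r)
      (nhdsWithin 0 (Set.Ioi 0)) (nhds 1) := by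
  have hn0 : n ≠ 0 := by omega
  exact ⟨fun r hr => ⟨rhoBall_innerRadius_subset hn0 hx hr, jBall_subset_rhoBall_outerRadius hn0 hx hr,
    fun s hs => le_innerRadius_of_subset hn0 hx hr hs,
    fun s hs => outerRadius_le_of_subset hn hx hr hs⟩, tendsto_outerRadius_div_innerRadius hx⟩
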